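/- **Theorem 2.1.** Let $(M,\mathrm{dist})$ be a compact metric space and $f:M\to M$ a homeomorphism with the periodic exponential specification property with rate $\theta>0$: for every $\delta>0$ there is an integer $S=S(\delta)>0$ such that for every $x\in M$ and every $n\in\mathbb N$ there is a point $p\in M$ with $f^{n+S}(p)=p$ and $$\mathrm{dist}(f^j(p),f^j(x))<\delta e^{-\theta\min\{j,\,n-j\}}\qquad\text{for all } j=0,1,\dots,n.$$ Let $A:M\to M(d,\mathbb R)$ be $\alpha$-Hölder continuous for some $\alpha>0$, i.e. there is $C>0$ with $\|A(x)-A(y)\|\le C\,\mathrm{dist}(x,y)^\alpha$ for all $x,y\in M$, where $\|\cdot\|$ is the operator norm, and let $A^n(x)=A(f^{n-1}(x))\cdots A(f(x))A(x)$. For an ergodic $f$-invariant Borel probability measure $\mu$, let $\gamma_1(A,\mu)\ge\dots\ge\gamma_d(A,\mu)\ge-\infty$ be the Lyapunov exponents of $(A,f)$ with respect to $\mu$, counted with multiplicity; that is, for $\mu$-almost every $x$ and every $c\in[-\infty,+\infty]$, the number of indices $i$ with $\gamma_i(A,\mu)\le c$ is the dimension of the subspace $\{v\in\mathbb R^d:\limsup_{n\to\infty}\frac1n\log\|A^n(x)v\|\le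 c\}$ (with $\log 0=-\infty$). Suppose that there are $\rho,\tau>0$ with $\rho+\tau<\frac{\alpha\theta}{2}$ such that $$-\tau\le\gamma_1(A,\mu)+\dots+\gamma_d(A,\mu)\le\rho$$ for every ergodic $f$-invariant Borel probability measure $\mu$ on $M$. Then $A(x)\in GL(d,\mathbb R)$ for every $x\in M$. -/

import Mathlib

open MeasureTheory Filter

noncomputable section

namespace SemiInvertible

/-- The cocycle generated by `A` over `f`: `A⁰(x) = Id` and
`Aⁿ(x) = A(fⁿ⁻¹(x)) ⋯ A(f(x)) A(x)`. -/
def cocycle {M : Type*} {d : ℕ} (A : M → Matrix (Fin d) (Fin d) ℝ) (f : M → M) :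
    ℕ → M → Matrix (Fin d) (Fin d) ℝ
  | 0, _ => 1
  | n + 1, x => A (f^[n] x) * cocycle A f n x

/-- The vector `Aⁿ(x) v`, in `ℝᵈ` with its Euclidean norm. -/
def orbitVec {M : Type*} {d : ℕ} (A : M → Matrix (Fin d) (Fin d) ℝ) (f : M → M) (x : M)
    (v : EuclideanSpace ℝ (Fin d)) (n : ℕ) : EuclideanSpace ℝ (Fin d) :=
  Matrix.toEuclideanCLM (n := Fin d) (𝕜 := ℝ) (cocycle A f n x) v

/-- The exponential growth rate `limsup (1/n) log ‖Aⁿ(x) v‖`, in `[-∞, +∞]`, with `log 0 = -∞`. -/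
def growthRate {M : Type*} {d : ℕ} (A : M → Matrix (Fin d) (Fin d) ℝ) (f : M → M) (x : M)
    (v : EuclideanSpace ℝ (Fin d)) : EReal :=
  limsup (fun n : ℕ => ENNReal.log ‖orbitVec A f x v n‖ₑ / (n : EReal)) atTop

theorem growthRate_eq {M : Type*} {d : ℕ} (A : M → Matrix (Fin d) (Fin d) ℝ) (f : M → M) (x : M)
    (v : EuclideanSpace ℝ (Fin d)) :
    growthRate A f x v = ExpGrowth.expGrowthSup (fun n => ‖orbitVec A f x v n‖ₑ) := rfl

theorem growthRate_zero {M : Type*} {d : ℕ} (A : M → Matrix (Fin d) (Fin d) ℝ) (f : M → M)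
    (x : M) : growthRate A f x 0 = ⊥ := by
  rw [growthRate_eq, ← ExpGrowth.expGrowthSup_zero]
  congr 1
  ext n
  simp [orbitVec]

theorem growthRate_add_le {M : Type*} {d : ℕ} (A : M → Matrix (Fin d) (Fin d) ℝ) (f : M → M)
    (x : M) (v w : EuclideanSpace ℝ (Fin d)) :
    growthRate A f x (v + w) ≤ growthRate A f x v ⊔ growthRate A f x w := by
  rw [growthRate_eq, growthRate_eq, growthRate_eq, ← ExpGrowth.expGrowthSup_add]
  refine ExpGrowth.expGrowthSup_monotone fun n => ?_
  simp only [orbitVec, map_add, Pi.add_apply]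
  exact enorm_add_le _ _

theorem growthRate_smul_le {M : Type*} {d : ℕ} (A : M → Matrix (Fin d) (Fin d) ℝ) (f : M → M)
    (x : M) (c : ℝ) (v : EuclideanSpace ℝ (Fin d)) :
    growthRate A f x (c • v) ≤ growthRate A f x v := by
  rw [growthRate_eq, growthRate_eq]
  refine ExpGrowth.expGrowthSup_le_of_eventually_le (b := ‖c‖ₑ) enorm_ne_top
    (Eventually.of_forall fun n => ?_)
  simp only [orbitVec, map_smul, enorm_smul]
  exact le_rfl

/-- The Lyapunov filtration of `ℝᵈ` at `x`: the subspace of the vectors whose growth rate is at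
most `c`. -/
def lyapunovFiltration {M : Type*} {d : ℕ} (A : M → Matrix (Fin d) (Fin d) ℝ) (f : M → M)
    (x : M) (c : EReal) : Submodule ℝ (EuclideanSpace ℝ (Fin d)) where
  carrier := {v | growthRate A f x v ≤ c}
  zero_mem' := by simp [growthRate_zero]
  add_mem' {v w} hv hw := (growthRate_add_le A f x v w).trans (sup_le hv hw)
  smul_mem' c v hv := (growthRate_smul_le A f x c v).trans hv

/-- The Lyapunov exponents of `(A, f)` at the point `x`, in decreasing order and counted with
multiplicity: for `i = 0, …, d - 1`, the `(i+1)`-st largest one is the least level `c` at which the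
Lyapunov filtration has dimension at least `d - i`. If `x` has a splitting `ℝᵈ = E¹ ⊕ ⋯ ⊕ Eˡ` with
`lim (1/n) log ‖Aⁿ(x) v‖ = λₖ` for every nonzero `v ∈ Eᵏ`, where `λ₁ > ⋯ > λₗ`, then the
filtration at level `c` is the sum of the `Eᵏ` with `λₖ ≤ c`, so that these are the numbers `λₖ`,
each repeated `dim Eᵏ` times. -/
def lyapunovExponentAt {M : Type*} {d : ℕ} (A : M → Matrix (Fin d) (Fin d) ℝ) (f : M → M)
    (x : M) (i : Fin d) : EReal :=
  sInf {c : EReal | d ≤ Module.finrank ℝ (lyapunovFiltration A f x c) + (i : ℕ)}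

/-- The Lyapunov exponent `γᵢ₊₁(A, μ) ∈ [-∞, +∞]` (`i = 0, …, d - 1`) of `(A, f)` with respect to
the ergodic measure `μ`: the value that the `(i+1)`-st largest Lyapunov exponent takes at
`μ`-almost every point. Being constant almost everywhere, that function has this value as its
essential supremum. -/
def lyapunovExponent {M : Type*} [MeasurableSpace M] {d : ℕ}
    (A : M → Matrix (Fin d) (Fin d) ℝ) (f : M → M) (μ : Measure M) (i : Fin d) : EReal :=
  essSup (fun x => lyapunovExponentAt A f x i) μ

/-- The periodic exponential specification property with rate `θ`. -/
def PeriodicExpSpecification {M : Type*} [MetricSpace M] (f : M → M) (θ : ℝ) : Prop :=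
  0 < θ ∧ ∀ δ : ℝ, 0 < δ → ∃ S : ℕ, 0 < S ∧ ∀ (x : M) (n : ℕ), ∃ p : M, f^[n + S] p = p ∧
    ∀ j : ℕ, j ≤ n →
      dist (f^[j] p) (f^[j] x) < δ * Real.exp (-θ * min (j : ℝ) ((n : ℝ) - (j : ℝ)))

/-- `A` is `α`-Hölder continuous with respect to the operator norm of matrices. -/
def IsHolder {M : Type*} [MetricSpace M] {d : ℕ} (A : M → Matrix (Fin d) (Fin d) ℝ) (α : ℝ) :
    Prop :=
  ∃ C : ℝ, 0 < C ∧ ∀ x y : M,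
    ‖Matrix.toEuclideanCLM (n := Fin d) (𝕜 := ℝ) (A x - A y)‖ ≤ C * dist x y ^ α

end SemiInvertible

end

/-!
The sum of the Lyapunov exponents is governed by `g = |det A|`, and only inequalities between the
two are needed, so that neither the multiplicative nor the pointwise ergodic theorem enters.

* At a periodic point `p` with `fᴺ p = p`, the exponents are at most `log |λᵢ| / N`, where the `λᵢ`
  are the eigenvalues of `Aᴺ(p)` (`lyapunovExponentAt_le_of_periodic`). Hence the lower bound `-τ`
  for the orbit measure gives `∏_{j<N} g (fʲ p) ≥ e^{-τN}` (`exp_le_abs_det_of_periodic`).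
* For an arbitrary ergodic measure, the upper bound `ρ` gives `|det Aⁿ(x)| ≤ e^{ρ'n}` for almost
  every `x`, every `ρ' > ρ` and large `n`, by a Hadamard-type inequality in a basis adapted to the
  Lyapunov filtration (`ae_eventually_abs_det_le`). With Fatou's lemma, `∫ log g dμ ≤ ρ`
  (`le_of_ae_eventually_prod_le`).

Suppose that `det A(x) = 0`. Specification for the orbit segment of length `2m` centred at `x`
provides a point `p` of period `N = 2m + S` with `dist (fᵐ p, x) < e^{-θm}`, so that
`g (fᵐ p) ≤ D e^{-αθm}`. As the product of `g` along the whole orbit is at least `e^{-τN}`, the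
remaining points make up for the small factor. Truncating `log g` from below at any fixed level
`-K`, its average along the orbit is therefore at least about `αθm / N - τ`, which tends to
`αθ/2 - τ > ρ` as `m → ∞` (`sub_le_sum_truncLog`).

It remains to pass from these periodic orbits to one ergodic measure `μ` with `∫ log g dμ > ρ`. The
invariant states on `C(M, ℝ)` that maximize the upper semicontinuous affine functional
`L ↦ inf_K L (log (max g e^{-K}))` form a compact face, which by the Krein–Milman lemma contains an
extreme invariant state, and extreme invariant states are ergodic measures
(`exists_ergodic_forall_le_integral`).
-/

noncomputable section

namespace SemiInvertible

/-! ### Growth of the powers of a matrix -/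

/-- The vectors `v` with `‖Tᵏ v‖ = O(rᵏ)`. -/
def powBounded {𝕜 V : Type*} [NormedField 𝕜] [SeminormedAddCommGroup V] [NormedSpace 𝕜 V]
    (T : Module.End 𝕜 V) (r : ℝ) : Submodule 𝕜 V where
  carrier := {v | ∃ C : ℝ, ∀ k : ℕ, ‖(T ^ k) v‖ ≤ C * r ^ k}
  zero_mem' := ⟨0, by simp⟩
  add_mem' := by
    rintro v w ⟨C, hC⟩ ⟨D, hD⟩
    refine ⟨C + D, fun k => ?_⟩
    rw [map_add, add_mul]
    exact (norm_add_le _ _).trans (add_le_add (hC k) (hD k))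
  smul_mem' := by
    rintro a v ⟨C, hC⟩
    refine ⟨‖a‖ * C, fun k => ?_⟩
    rw [map_smul, norm_smul, mul_assoc]
    exact mul_le_mul_of_nonneg_left (hC k) (norm_nonneg _)

/-- If `T v = l v + w` with `‖l‖ < r` and `w` grows at most like `rᵏ`, then so does `v`. -/
theorem mem_powBounded_of_sub_smul_mem {𝕜 V : Type*} [NormedField 𝕜] [SeminormedAddCommGroup V]
    [NormedSpace 𝕜 V] {T : Module.End 𝕜 V} {r : ℝ} {l : 𝕜} (hl : ‖l‖ < r) {v : V}
    (hv : T v - l • v ∈ powBounded T r) : v ∈ powBounded T r := by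
  obtain ⟨C, hC⟩ := hv
  have hr : 0 < r := (norm_nonneg l).trans_lt hl
  have hrl : 0 < r - ‖l‖ := sub_pos.2 hl
  refine ⟨max ‖v‖ (C / (r - ‖l‖)), fun k => ?_⟩
  set D := max ‖v‖ (C / (r - ‖l‖))
  induction k with
  | zero => simp [D]
  | succ k ih =>
    have hD : C ≤ D * (r - ‖l‖) := (div_le_iff₀ hrl).1 (le_max_right _ _)
    have hstep : (T ^ (k + 1)) v = l • (T ^ k) v + (T ^ k) (T v - l • v) := by
      rw [pow_succ, Module.End.mul_apply, map_sub, map_smul]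
      abel
    calc ‖(T ^ (k + 1)) v‖ ≤ ‖l‖ * ‖(T ^ k) v‖ + ‖(T ^ k) (T v - l • v)‖ := by
          rw [hstep, ← norm_smul]
          exact norm_add_le _ _
      _ ≤ ‖l‖ * (D * r ^ k) + D * (r - ‖l‖) * r ^ k :=
          add_le_add (mul_le_mul_of_nonneg_left ih (norm_nonneg _))
            ((hC k).trans (mul_le_mul_of_nonneg_right hD (pow_pos hr k).le))
      _ = D * r ^ (k + 1) := by ring

theorem maxGenEigenspace_le_powBounded {𝕜 V : Type*} [NormedField 𝕜] [SeminormedAddCommGroup V]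
    [NormedSpace 𝕜 V] (T : Module.End 𝕜 V) {r : ℝ} {l : 𝕜} (hl : ‖l‖ < r) :
    T.maxGenEigenspace l ≤ powBounded T r := by
  intro v hv
  obtain ⟨m, hm⟩ := (Module.End.mem_maxGenEigenspace T l v).1 hv
  clear hv
  induction m generalizing v with
  | zero =>
    rw [pow_zero, Module.End.one_apply] at hm
    rw [hm]
    exact zero_mem _
  | succ m ih =>
    refine mem_powBounded_of_sub_smul_mem hl (ih ?_)
    rw [pow_succ, Module.End.mul_apply] at hm
    simpa using hm

theorem finrank_finsetSup_eq_sum {ι K V : Type*} [DivisionRing K] [AddCommGroup V] [Module K V]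
    [FiniteDimensional K V] {W : ι → Submodule K V} (hW : iSupIndep W) (s : Finset ι) :
    Module.finrank K (s.sup W : Submodule K V) = ∑ i ∈ s, Module.finrank K (W i) := by
  classical
  induction s using Finset.induction_on with
  | empty => simp
  | insert a s ha ih =>
    have hdis : Disjoint (W a) (s.sup W) :=
      hW.supIndep' (insert a s) (Finset.subset_insert a s) (Finset.mem_insert_self a s) ha
    have h := Submodule.finrank_sup_add_finrank_inf_eq (W a) (s.sup W)
    rw [hdis.eq_bot, finrank_bot, add_zero] at h
    rw [Finset.sup_insert, h, ih, Finset.sum_insert ha]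

/-- The vectors growing at most like `rᵏ` under `T` fill a space whose dimension is at least the
number of eigenvalues of modulus less than `r`. -/
theorem card_filter_roots_le_finrank_powBounded {V : Type*} [NormedAddCommGroup V]
    [NormedSpace ℂ V] [FiniteDimensional ℂ V] (T : Module.End ℂ V) (r : ℝ) :
    (T.charpoly.roots.filter fun l => ‖l‖ < r).card ≤ Module.finrank ℂ (powBounded T r) := by
  classical
  set m := T.charpoly.roots.filter fun l => ‖l‖ < r
  calc m.card = ∑ l ∈ m.toFinset, m.count l := (Multiset.toFinset_sum_count_eq m).symm
    _ ≤ ∑ l ∈ m.toFinset, Module.finrank ℂ (T.maxGenEigenspace l) := by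
        refine Finset.sum_le_sum fun l _ => ?_
        rw [LinearMap.finrank_maxGenEigenspace_eq, ← Polynomial.count_roots]
        exact Multiset.count_le_of_le _ (Multiset.filter_le _ _)
    _ = Module.finrank ℂ (m.toFinset.sup T.maxGenEigenspace : Submodule ℂ V) :=
        (finrank_finsetSup_eq_sum T.independent_maxGenEigenspace _).symm
    _ ≤ Module.finrank ℂ (powBounded T r) := by
        refine Submodule.finrank_mono (Finset.sup_le fun l hl => ?_)
        exact maxGenEigenspace_le_powBounded T
          (Multiset.mem_filter.1 (Multiset.mem_toFinset.1 hl)).2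

/-- The endomorphism of `𝕜ᵈ` given by a square matrix. -/
abbrev matrixEnd {𝕜 : Type*} [RCLike 𝕜] {d : ℕ} (B : Matrix (Fin d) (Fin d) 𝕜) :
    Module.End 𝕜 (EuclideanSpace 𝕜 (Fin d)) :=
  (Matrix.toEuclideanCLM (n := Fin d) (𝕜 := 𝕜) B : _ →ₗ[𝕜] _)

theorem matrixEnd_pow_apply {𝕜 : Type*} [RCLike 𝕜] {d : ℕ} (B : Matrix (Fin d) (Fin d) 𝕜) (k : ℕ)
    (v : EuclideanSpace 𝕜 (Fin d)) :
    (matrixEnd B ^ k) v = Matrix.toEuclideanCLM (n := Fin d) (𝕜 := 𝕜) (B ^ k) v := by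
  rw [map_pow, matrixEnd, Module.End.pow_apply]
  induction k with
  | zero => rfl
  | succ k ih => rw [Function.iterate_succ_apply', ih, pow_succ']; rfl

/-- A real matrix has, over `ℝ`, at least as many slowly growing vectors as over `ℂ`: the real and
imaginary parts of a slowly growing complex vector grow slowly. -/
theorem finrank_powBounded_complex_le {d : ℕ} (B : Matrix (Fin d) (Fin d) ℝ) (r : ℝ) :
    Module.finrank ℂ (powBounded (matrixEnd (B.map Complex.ofRealHom)) r) ≤
      Module.finrank ℝ (powBounded (matrixEnd B) r) := by
  set Wc := powBounded (matrixEnd (B.map Complex.ofRealHom)) r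
  set Wr := powBounded (matrixEnd B) r
  let ι : EuclideanSpace ℝ (Fin d) →ₗ[ℝ] EuclideanSpace ℂ (Fin d) :=
    { toFun := fun v => WithLp.toLp 2 fun i => (v i : ℂ)
      map_add' := fun v w => by ext i; simp
      map_smul' := fun c v => by ext i; simp }
  let re : EuclideanSpace ℂ (Fin d) → EuclideanSpace ℝ (Fin d) :=
    fun v => WithLp.toLp 2 fun i => (v i).re
  let im : EuclideanSpace ℂ (Fin d) → EuclideanSpace ℝ (Fin d) :=
    fun v => WithLp.toLp 2 fun i => (v i).im
  have hre : ∀ v, ‖re v‖ ≤ ‖v‖ := fun v => by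
    rw [EuclideanSpace.norm_eq, EuclideanSpace.norm_eq]
    exact Real.sqrt_le_sqrt (Finset.sum_le_sum fun i _ =>
      pow_le_pow_left₀ (norm_nonneg _) (Complex.abs_re_le_norm (v i)) 2)
  have him : ∀ v, ‖im v‖ ≤ ‖v‖ := fun v => by
    rw [EuclideanSpace.norm_eq, EuclideanSpace.norm_eq]
    exact Real.sqrt_le_sqrt (Finset.sum_le_sum fun i _ =>
      pow_le_pow_left₀ (norm_nonneg _) (Complex.abs_im_le_norm (v i)) 2)
  have hpow : ∀ k : ℕ, (B.map Complex.ofRealHom) ^ k = (B ^ k).map Complex.ofRealHom := fun k =>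
    by rw [← RingHom.mapMatrix_apply, ← map_pow, RingHom.mapMatrix_apply]
  have hre_pow : ∀ (k : ℕ) (v : EuclideanSpace ℂ (Fin d)),
      (matrixEnd B ^ k) (re v) = re ((matrixEnd (B.map Complex.ofRealHom) ^ k) v) := fun k v => by
    rw [matrixEnd_pow_apply, matrixEnd_pow_apply, hpow]
    ext i
    change ((B ^ k).mulVec fun i => (v i).re) i =
      (((B ^ k).map Complex.ofRealHom).mulVec (WithLp.ofLp v) i).re
    simp [Matrix.mulVec, dotProduct]
  have him_pow : ∀ (k : ℕ) (v : EuclideanSpace ℂ (Fin d)),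
      (matrixEnd B ^ k) (im v) = im ((matrixEnd (B.map Complex.ofRealHom) ^ k) v) := fun k v => by
    rw [matrixEnd_pow_apply, matrixEnd_pow_apply, hpow]
    ext i
    change ((B ^ k).mulVec fun i => (v i).im) i =
      (((B ^ k).map Complex.ofRealHom).mulVec (WithLp.ofLp v) i).im
    simp [Matrix.mulVec, dotProduct]
  let b := Module.finBasis ℝ Wr
  set S := Submodule.span ℂ (Set.range fun i => ι (b i))
  have hιS : ∀ u ∈ Wr, ι u ∈ S := fun u hu => by
    have h := congrArg (fun w : Wr => ι (w : EuclideanSpace ℝ (Fin d))) (b.sum_repr ⟨u, hu⟩)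
    simp only [Submodule.coe_sum, Submodule.coe_smul, map_sum, map_smul] at h
    rw [← h]
    refine Submodule.sum_mem _ fun i _ => ?_
    rw [← Complex.coe_smul]
    exact Submodule.smul_mem _ _ (Submodule.subset_span ⟨i, rfl⟩)
  have hle : Wc ≤ S := by
    rintro v ⟨C, hC⟩
    have h1 : re v ∈ Wr := ⟨C, fun k => by rw [hre_pow]; exact (hre _).trans (hC k)⟩
    have h2 : im v ∈ Wr := ⟨C, fun k => by rw [him_pow]; exact (him _).trans (hC k)⟩
    have hv : v = ι (re v) + Complex.I • ι (im v) := by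
      ext i
      simp only [ι, re, im, LinearMap.coe_mk, AddHom.coe_mk, PiLp.add_apply, PiLp.smul_apply,
        smul_eq_mul]
      rw [mul_comm, Complex.re_add_im]
    rw [hv]
    exact S.add_mem (hιS _ h1) (S.smul_mem _ (hιS _ h2))
  calc Module.finrank ℂ Wc ≤ Module.finrank ℂ S := Submodule.finrank_mono hle
    _ ≤ Fintype.card (Fin (Module.finrank ℝ Wr)) := finrank_range_le_card _
    _ = Module.finrank ℝ Wr := Fintype.card_fin _

/-- A finite multiset of reals can be listed in decreasing order. -/
theorem exists_antitone_map_univ_eq {d : ℕ} (m : Multiset ℝ) (hm : m.card = d) :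
    ∃ r : Fin d → ℝ, Antitone r ∧ Finset.univ.val.map r = m := by
  obtain rfl : (m.sort (· ≥ ·)).length = d := by rw [Multiset.length_sort, hm]
  refine ⟨(m.sort (· ≥ ·)).get, (Multiset.pairwise_sort m (· ≥ ·)).sortedGE.antitone_get, ?_⟩
  rw [Fin.univ_val_map, List.ofFn_get, Multiset.sort_eq]

/-! ### Lyapunov exponents along a periodic orbit -/

theorem cocycle_add {M : Type*} {d : ℕ} (A : M → Matrix (Fin d) (Fin d) ℝ) (f : M → M)
    (m n : ℕ) (x : M) : cocycle A f (m + n) x = cocycle A f m (f^[n] x) * cocycle A f n x := by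
  induction m with
  | zero => simp [cocycle]
  | succ m ih =>
    rw [Nat.succ_add, cocycle, ih, cocycle, Matrix.mul_assoc, Function.iterate_add_apply]

theorem det_cocycle {M : Type*} {d : ℕ} (A : M → Matrix (Fin d) (Fin d) ℝ) (f : M → M)
    (n : ℕ) (x : M) : (cocycle A f n x).det = ∏ j ∈ Finset.range n, (A (f^[j] x)).det := by
  induction n with
  | zero => simp [cocycle]
  | succ n ih => rw [cocycle, Matrix.det_mul, ih, Finset.prod_range_succ, mul_comm]

theorem cocycle_mul_of_isPeriodicPt {M : Type*} {d : ℕ} (A : M → Matrix (Fin d) (Fin d) ℝ)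
    {f : M → M} {N : ℕ} {x : M} (hx : f^[N] x = x) (k : ℕ) :
    cocycle A f (N * k) x = cocycle A f N x ^ k := by
  induction k with
  | zero => simp [cocycle]
  | succ k ih =>
    have hk : f^[N * k] x = x := Function.IsPeriodicPt.mul_const hx k
    rw [Nat.mul_succ, add_comm, cocycle_add, hk, ih, pow_succ']

/-- Along a periodic orbit, the matrices over one period are products of the same factors up to
cyclic permutation, hence have the same characteristic polynomial. -/
theorem charpoly_cocycle_iterate {M : Type*} {d : ℕ} (A : M → Matrix (Fin d) (Fin d) ℝ)
    {f : M → M} {N : ℕ} {x : M} (hx : f^[N] x = x) (j : ℕ) :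
    (cocycle A f N (f^[j] x)).charpoly = (cocycle A f N x).charpoly := by
  induction j with
  | zero => rfl
  | succ j ih =>
    rw [← ih, Function.iterate_succ_apply']
    set y := f^[j] x
    have hper : f^[N] y = y := Function.IsPeriodicPt.apply_iterate (f := f) hx j
    cases N with
    | zero => rfl
    | succ n =>
      have h1 : cocycle A f (n + 1) y = cocycle A f n (f y) * A y := by
        rw [cocycle_add]
        simp [cocycle]
      have h2 : cocycle A f (n + 1) (f y) = A y * cocycle A f n (f y) := by
        rw [cocycle, ← Function.iterate_succ_apply, hper]
      rw [h1, h2, Matrix.charpoly_mul_comm]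

theorem growthRate_le_of_norm_le {M : Type*} {d : ℕ} {A : M → Matrix (Fin d) (Fin d) ℝ}
    {f : M → M} {x : M} {v : EuclideanSpace ℝ (Fin d)} {C c : ℝ}
    (h : ∀ n : ℕ, ‖orbitVec A f x v n‖ ≤ C * Real.exp (c * n)) : growthRate A f x v ≤ c := by
  rw [growthRate_eq, ← ExpGrowth.expGrowthSup_exp (a := (c : EReal))]
  refine ExpGrowth.expGrowthSup_le_of_eventually_le (b := ENNReal.ofReal C) ENNReal.ofReal_ne_top
    (Eventually.of_forall fun n => ?_)
  have hC : 0 ≤ C := by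
    have := (norm_nonneg _).trans (h 0)
    simpa using this
  have hexp : EReal.exp ((c : EReal) * (n : EReal)) = ENNReal.ofReal (Real.exp (c * n)) := by
    rw [← EReal.coe_coe_eq_natCast, ← EReal.coe_mul, EReal.exp_coe]
  simp only [hexp]
  rw [← ENNReal.ofReal_mul hC, ← ofReal_norm]
  exact ENNReal.ofReal_le_ofReal (h n)

/-- A vector growing at most like `e^{cNk}` under the `k`-th power of the period matrix has
exponential growth rate at most `c`. -/
theorem powBounded_le_lyapunovFiltration {M : Type*} {d : ℕ} (A : M → Matrix (Fin d) (Fin d) ℝ)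
    {f : M → M} {N : ℕ} (hN : 0 < N) {x : M} (hx : f^[N] x = x) (c : ℝ) :
    powBounded (matrixEnd (cocycle A f N x)) (Real.exp (N * c)) ≤
      lyapunovFiltration A f x (c : EReal) := by
  rintro v ⟨C, hC⟩
  have hC0 : 0 ≤ C := by simpa using (norm_nonneg _).trans (hC 0)
  set D : ℝ := ∑ s ∈ Finset.range N,
    ‖Matrix.toEuclideanCLM (n := Fin d) (𝕜 := ℝ) (cocycle A f s x)‖ * Real.exp (-(c * s))
  refine growthRate_le_of_norm_le (C := D * C) fun n => ?_
  set s := n % N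
  set k := n / N
  have hn : n = s + N * k := (Nat.mod_add_div n N).symm
  have hs : s ∈ Finset.range N := Finset.mem_range.2 (Nat.mod_lt n hN)
  have hk : f^[N * k] x = x := Function.IsPeriodicPt.mul_const hx k
  have hsplit : orbitVec A f x v n = Matrix.toEuclideanCLM (n := Fin d) (𝕜 := ℝ)
      (cocycle A f s x) ((matrixEnd (cocycle A f N x) ^ k) v) := by
    rw [matrixEnd_pow_apply, ← cocycle_mul_of_isPeriodicPt A hx]
    conv_lhs => rw [orbitVec, hn, cocycle_add, hk, map_mul]
    rfl
  have hexp : Real.exp (N * c) ^ k = Real.exp (-(c * s)) * Real.exp (c * n) := by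
    rw [← Real.exp_nat_mul, ← Real.exp_add]
    congr 1
    conv_rhs => rw [hn]
    push_cast
    ring
  rw [hsplit]
  calc _ ≤ ‖Matrix.toEuclideanCLM (n := Fin d) (𝕜 := ℝ) (cocycle A f s x)‖ *
        (C * Real.exp (N * c) ^ k) :=
        (ContinuousLinearMap.le_opNorm _ _).trans
          (mul_le_mul_of_nonneg_left (hC k) (norm_nonneg _))
    _ = (‖Matrix.toEuclideanCLM (n := Fin d) (𝕜 := ℝ) (cocycle A f s x)‖ *
        Real.exp (-(c * s))) * (C * Real.exp (c * n)) := by rw [hexp]; ring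
    _ ≤ D * (C * Real.exp (c * n)) := by
        refine mul_le_mul_of_nonneg_right ?_ (by positivity)
        exact Finset.single_le_sum (f := fun s : ℕ =>
          ‖Matrix.toEuclideanCLM (n := Fin d) (𝕜 := ℝ) (cocycle A f s x)‖ * Real.exp (-(c * s)))
          (fun s _ => by positivity) hs
    _ = D * C * Real.exp (c * n) := by ring

/-- If the moduli of the eigenvalues of the period matrix are `r 0 ≥ r 1 ≥ ⋯`, then the `(i+1)`-st
Lyapunov exponent is at most `log (r i) / N`. -/
theorem lyapunovExponentAt_le_of_periodic {M : Type*} {d : ℕ}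
    (A : M → Matrix (Fin d) (Fin d) ℝ) {f : M → M} {N : ℕ} (hN : 0 < N) {x : M}
    (hx : f^[N] x = x) {r : Fin d → ℝ} (hr : Antitone r)
    (hroots : Finset.univ.val.map r =
      ((cocycle A f N x).charpoly.map Complex.ofRealHom).roots.map fun l => ‖l‖)
    {i : Fin d} {c : ℝ} (hc : r i < Real.exp (N * c)) :
    lyapunovExponentAt A f x i ≤ c := by
  refine sInf_le ?_
  set B := cocycle A f N x
  have h1 := card_filter_roots_le_finrank_powBounded
    (matrixEnd (B.map Complex.ofRealHom)) (Real.exp (N * c))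
  have hchar : LinearMap.charpoly (matrixEnd (B.map Complex.ofRealHom)) =
      B.charpoly.map Complex.ofRealHom := by
    rw [← Matrix.charpoly_map]
    exact Matrix.charpoly_toLin _ (EuclideanSpace.basisFun (Fin d) ℂ).toBasis
  have h2 : ((B.charpoly.map Complex.ofRealHom).roots.filter
      fun l => ‖l‖ < Real.exp (N * c)).card =
      (Finset.univ.filter fun j => r j < Real.exp (N * c)).card := by
    have h := congrArg (fun m => (m.filter fun t => t < Real.exp (N * c)).card) hroots
    simp only [Multiset.filter_map, Multiset.card_map] at h
    exact h.symm
  have h3 : d - i ≤ (Finset.univ.filter fun j => r j < Real.exp (N * c)).card := by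
    rw [← Fin.card_Ici]
    refine Finset.card_le_card fun j hj => ?_
    simp only [Finset.mem_filter, Finset.mem_univ, true_and]
    exact (hr (Finset.mem_Ici.1 hj)).trans_lt hc
  rw [hchar, h2] at h1
  have h4 := finrank_powBounded_complex_le B (Real.exp (N * c))
  have h5 : Module.finrank ℝ (powBounded (matrixEnd B) (Real.exp (N * c))) ≤ _ :=
    Submodule.finrank_mono (powBounded_le_lyapunovFiltration A hN hx c)
  change d ≤ Module.finrank ℝ (lyapunovFiltration A f x c) + (i : ℕ)
  omega

/-- The uniform measure on the orbit segment `x, f x, …, f^{N-1} x`. -/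
def orbitMeasure {M : Type*} [MeasurableSpace M] (f : M → M) (N : ℕ) (x : M) : Measure M :=
  (N : ENNReal)⁻¹ • ∑ j ∈ Finset.range N, Measure.dirac (f^[j] x)

theorem isProbabilityMeasure_orbitMeasure {M : Type*} [MeasurableSpace M] (f : M → M) {N : ℕ}
    (hN : 0 < N) (x : M) : IsProbabilityMeasure (orbitMeasure f N x) := by
  refine ⟨?_⟩
  simp only [orbitMeasure, Measure.smul_apply, Measure.finsetSum_apply, measure_univ,
    Finset.sum_const, Finset.card_range, nsmul_eq_mul, mul_one, smul_eq_mul]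
  exact ENNReal.inv_mul_cancel (by exact_mod_cast hN.ne') (ENNReal.natCast_ne_top N)

theorem ae_orbitMeasure_of_forall {M : Type*} [MeasurableSpace M] [MeasurableSingletonClass M]
    {f : M → M} {N : ℕ} {x : M} {P : M → Prop} (h : ∀ j, P (f^[j] x)) :
    ∀ᵐ y ∂orbitMeasure f N x, P y := by
  rw [ae_iff]
  simp only [orbitMeasure, Measure.smul_apply, Measure.finsetSum_apply, smul_eq_mul,
    Measure.dirac_apply]
  simp [h]

theorem map_orbitMeasure {M : Type*} [MeasurableSpace M] {f : M → M} (hf : Measurable f) {N : ℕ}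
    {x : M} (hx : f^[N] x = x) : (orbitMeasure f N x).map f = orbitMeasure f N x := by
  have hsum : ∑ j ∈ Finset.range N, (Measure.dirac (f^[j] x)).map f =
      ∑ j ∈ Finset.range N, Measure.dirac (f^[j] x) := by
    have h : ∀ j, (Measure.dirac (f^[j] x)).map f = Measure.dirac (f^[j + 1] x) := fun j => by
      rw [Measure.map_dirac' hf, Function.iterate_succ_apply']
    rw [Finset.sum_congr rfl fun j _ => h j]
    cases N with
    | zero => simp only [Finset.sum_range_zero]
    | succ n => rw [Finset.sum_range_succ, hx, Finset.sum_range_succ', Function.iterate_zero_apply]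
  rw [orbitMeasure, Measure.map_smul, ← Measure.mapₗ_apply_of_measurable hf, map_sum]
  simp_rw [Measure.mapₗ_apply_of_measurable hf]
  rw [hsum]

theorem ergodic_orbitMeasure {M : Type*} [MeasurableSpace M] [MeasurableSingletonClass M]
    {f : M → M} (hf : Measurable f) {N : ℕ} {x : M} (hx : f^[N] x = x) :
    Ergodic f (orbitMeasure f N x) := by
  refine ⟨⟨hf, map_orbitMeasure hf hx⟩, ⟨fun s _ hs => ?_⟩⟩
  have hmem : ∀ j, f^[j] x ∈ s ↔ x ∈ s := fun j => by
    induction j with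
    | zero => exact Iff.rfl
    | succ j ih => rw [Function.iterate_succ_apply', ← Set.mem_preimage, hs, ih]
  rw [eventuallyConst_set]
  by_cases hxs : x ∈ s
  · exact Or.inl (ae_orbitMeasure_of_forall fun j => (hmem j).2 hxs)
  · have hnot : ∀ j, f^[j] x ∉ s := fun j h => hxs ((hmem j).1 h)
    exact Or.inr (ae_orbitMeasure_of_forall (P := fun y => y ∉ s) hnot)

theorem coe_finsetSum_ereal {ι : Type*} (s : Finset ι) (u : ι → ℝ) :
    ((∑ i ∈ s, u i : ℝ) : EReal) = ∑ i ∈ s, (u i : EReal) := by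
  classical
  induction s using Finset.induction_on with
  | empty => simp
  | insert a s ha ih => rw [Finset.sum_insert ha, Finset.sum_insert ha, EReal.coe_add, ih]

/-- The sum of the Lyapunov exponents of a periodic orbit is at most `(1/N) log |det Aᴺ|`, so that a
lower bound for it bounds the determinant over one period from below. The bound also covers the
case of a zero eigenvalue, where both sides of the inequality are `-∞`. -/
theorem exp_le_abs_det_of_periodic {M : Type*} [MeasurableSpace M] [MeasurableSingletonClass M]
    {d : ℕ} (A : M → Matrix (Fin d) (Fin d) ℝ) {f : M → M} {N : ℕ} (hN : 0 < N) {x : M}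
    (hx : f^[N] x = x) {τ : ℝ}
    (h : ((-τ : ℝ) : EReal) ≤ ∑ i : Fin d, lyapunovExponent A f (orbitMeasure f N x) i) :
    Real.exp (-τ * N) ≤ |(cocycle A f N x).det| := by
  set B := cocycle A f N x
  set p : Polynomial ℂ := B.charpoly.map Complex.ofRealHom with hp
  have hdeg : p.natDegree = d := by
    rw [hp, Polynomial.natDegree_map, Matrix.charpoly_natDegree_eq_dim, Fintype.card_fin]
  obtain ⟨r, hr, hroots⟩ := exists_antitone_map_univ_eq (d := d) (p.roots.map fun l => ‖l‖)
    (by rw [Multiset.card_map, IsAlgClosed.card_roots_eq_natDegree, hdeg])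
  have hr0 : ∀ i, 0 ≤ r i := fun i => by
    have : r i ∈ p.roots.map fun l => ‖l‖ := by
      rw [← hroots]
      exact Multiset.mem_map_of_mem r (Finset.mem_univ_val i)
    obtain ⟨l, -, hl⟩ := Multiset.mem_map.1 this
    exact hl ▸ norm_nonneg l
  have hdet : |B.det| = ∏ i, r i := by
    have h1 : ((B.det : ℝ) : ℂ) = p.roots.prod := by
      rw [hp, ← Matrix.charpoly_map, ← Matrix.det_eq_prod_roots_charpoly]
      exact RingHom.map_det Complex.ofRealHom B
    have h2 := congrArg Multiset.prod hroots
    rw [← Real.norm_eq_abs, ← Complex.norm_real, h1, Finset.prod, h2]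
    exact (p.roots.prod_hom (normHom : ℂ →*₀ ℝ)).symm
  by_contra hlt
  push Not at hlt
  rw [hdet] at hlt
  -- Replacing each `r i` by `r i + η` removes the zero eigenvalues.
  obtain ⟨η, hη, hηlt⟩ : ∃ η : ℝ, 0 < η ∧ ∏ i, (r i + η) < Real.exp (-τ * N) := by
    have hcont : Continuous fun η : ℝ => ∏ i, (r i + η) := by fun_prop
    have hev : ∀ᶠ η in nhds (0 : ℝ), ∏ i, (r i + η) < Real.exp (-τ * N) :=
      hcont.continuousAt.eventually_lt continuousAt_const (by simpa using hlt)
    obtain ⟨η, hη, hpos⟩ := ((hev.filter_mono nhdsWithin_le_nhds).and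
      (self_mem_nhdsWithin (s := Set.Ioi (0 : ℝ)))).exists
    exact ⟨η, hpos, hη⟩
  have hpos : ∀ i, 0 < r i + η := fun i => add_pos_of_nonneg_of_pos (hr0 i) hη
  have hN' : (0 : ℝ) < N := by exact_mod_cast hN
  have hle : ∀ i, lyapunovExponent A f (orbitMeasure f N x) i ≤
      ((Real.log (r i + η) / N : ℝ) : EReal) := fun i => by
    refine essSup_le_of_ae_le _ (ae_orbitMeasure_of_forall fun j => ?_)
    refine lyapunovExponentAt_le_of_periodic A hN (r := r)
      (Function.IsPeriodicPt.apply_iterate (f := f) hx j) hr ?_ ?_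
    · rw [charpoly_cocycle_iterate A hx, hroots]
    · rw [mul_div_cancel₀ _ hN'.ne', Real.exp_log (hpos i)]
      linarith
  have hsum := h.trans (Finset.sum_le_sum fun i _ => hle i)
  rw [← coe_finsetSum_ereal, EReal.coe_le_coe_iff, ← Finset.sum_div, le_div_iff₀ hN',
    ← Real.log_prod (fun i _ => (hpos i).ne'),
    Real.le_log_iff_exp_le (Finset.prod_pos fun i _ => hpos i)] at hsum
  exact hsum.not_gt hηlt

/-! ### Lyapunov exponents bound the growth of the determinant -/

/-- Subspaces `W 0, W 1, …` with `dim (W k) > k` contain linearly independent `v k ∈ W k`. -/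
theorem exists_linearIndependent_mem {K V : Type*} [DivisionRing K] [AddCommGroup V] [Module K V]
    [FiniteDimensional K V] {n : ℕ} (W : Fin n → Submodule K V)
    (hW : ∀ k : Fin n, (k : ℕ) < Module.finrank K (W k)) :
    ∃ v : Fin n → V, (∀ k, v k ∈ W k) ∧ LinearIndependent K v := by
  induction n with
  | zero => exact ⟨Fin.elim0, fun k => k.elim0, linearIndependent_empty_type⟩
  | succ n ih =>
    obtain ⟨v, hv, hind⟩ := ih (fun k => W k.castSucc) fun k => hW k.castSucc
    obtain ⟨w, hw, hnot⟩ : ∃ w ∈ W (Fin.last n), w ∉ Submodule.span K (Set.range v) := by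
      by_contra! hcon
      have h1 : Module.finrank K (W (Fin.last n)) ≤ _ :=
        Submodule.finrank_mono (show W (Fin.last n) ≤ _ from hcon)
      have h2 := finrank_span_eq_card hind
      have h3 := hW (Fin.last n)
      rw [Fintype.card_fin] at h2
      rw [Fin.val_last] at h3
      omega
    refine ⟨Fin.snoc v w, fun k => ?_, linearIndependent_finSnoc.2 ⟨hind, hnot⟩⟩
    refine Fin.lastCases ?_ (fun j => ?_) k
    · rwa [Fin.snoc_last]
    · rw [Fin.snoc_castSucc]
      exact hv j

/-- A crude form of Hadamard's inequality, relative to a basis. -/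
theorem exists_abs_det_le_prod_norm {d : ℕ} {v : Fin d → EuclideanSpace ℝ (Fin d)}
    (hv : LinearIndependent ℝ v) : ∃ C : ℝ, ∀ B : Matrix (Fin d) (Fin d) ℝ,
      |B.det| ≤ C * ∏ i, ‖Matrix.toEuclideanCLM (n := Fin d) (𝕜 := ℝ) B (v i)‖ := by
  set V : Matrix (Fin d) (Fin d) ℝ := Matrix.of fun i j => v j i
  have hdet : V.det ≠ 0 := by
    rw [← isUnit_iff_ne_zero, ← Matrix.isUnit_iff_isUnit_det,
      ← Matrix.linearIndependent_cols_iff_isUnit]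
    exact hv.map' (WithLp.linearEquiv 2 ℝ (Fin d → ℝ)).toLinearMap (LinearEquiv.ker _)
  refine ⟨(Fintype.card (Equiv.Perm (Fin d))) / |V.det|, fun B => ?_⟩
  have hcol : ∀ i j, (B * V) i j = Matrix.toEuclideanCLM (n := Fin d) (𝕜 := ℝ) B (v j) i :=
    fun i j => rfl
  rw [div_mul_eq_mul_div, le_div_iff₀ (abs_pos.2 hdet), ← abs_mul, ← Matrix.det_mul,
    Matrix.det_apply]
  refine (Finset.abs_sum_le_sum_abs _ _).trans ?_
  rw [← nsmul_eq_mul, ← Finset.card_univ]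
  refine Finset.sum_le_card_nsmul _ _ _ fun σ _ => ?_
  have hsign : |Equiv.Perm.sign σ • ∏ i, (B * V) (σ i) i| = |∏ i, (B * V) (σ i) i| := by
    rcases Int.units_eq_one_or (Equiv.Perm.sign σ) with h | h <;> simp [h, Units.smul_def]
  rw [hsign, Finset.abs_prod]
  refine Finset.prod_le_prod (fun i _ => abs_nonneg _) fun i _ => ?_
  rw [hcol, ← Real.norm_eq_abs]
  exact PiLp.norm_apply_le _ _

theorem eventually_norm_le_of_growthRate_lt {M : Type*} {d : ℕ}
    {A : M → Matrix (Fin d) (Fin d) ℝ} {f : M → M} {x : M} {v : EuclideanSpace ℝ (Fin d)} {c : ℝ}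
    (h : growthRate A f x v < c) :
    ∀ᶠ n : ℕ in atTop, ‖orbitVec A f x v n‖ ≤ Real.exp (c * n) := by
  rw [growthRate_eq] at h
  filter_upwards [ExpGrowth.eventually_le_exp h] with n hn
  rwa [← EReal.coe_coe_eq_natCast, ← EReal.coe_mul, EReal.exp_coe, ← ofReal_norm,
    ENNReal.ofReal_le_ofReal_iff (Real.exp_pos _).le] at hn

/-- If the Lyapunov exponents at `x` are less than `c 0, c 1, …`, then `|det Aⁿ(x)|` grows at most
like `exp (n ∑ c i)`. A basis of `ℝᵈ` adapted to the Lyapunov filtration is sent by `Aⁿ(x)` to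
vectors of length at most `exp (n c i)`. -/
theorem exists_eventually_abs_det_le {M : Type*} {d : ℕ} (A : M → Matrix (Fin d) (Fin d) ℝ)
    (f : M → M) {x : M} {c : Fin d → ℝ} (hc : ∀ i, lyapunovExponentAt A f x i < c i) :
    ∃ C : ℝ, ∀ᶠ n : ℕ in atTop, |(cocycle A f n x).det| ≤ C * Real.exp ((∑ i, c i) * n) := by
  have hdim : ∀ i : Fin d, ∃ b : EReal, b < c i ∧
      d ≤ Module.finrank ℝ (lyapunovFiltration A f x b) + (i : ℕ) := fun i => by
    obtain ⟨b, hb, hbc⟩ := sInf_lt_iff.1 (hc i)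
    exact ⟨b, hbc, hb⟩
  choose b hbc hb using hdim
  obtain ⟨v, hv, hind⟩ := exists_linearIndependent_mem
    (fun k : Fin d => lyapunovFiltration A f x (b k.rev)) fun k => by
      have := hb k.rev
      rw [Fin.val_rev] at this
      omega
  obtain ⟨C, hC⟩ := exists_abs_det_le_prod_norm hind
  refine ⟨|C|, ?_⟩
  have hev : ∀ k : Fin d, ∀ᶠ n : ℕ in atTop,
      ‖orbitVec A f x (v k) n‖ ≤ Real.exp (c k.rev * n) := fun k =>
    eventually_norm_le_of_growthRate_lt
      ((show growthRate A f x (v k) ≤ b k.rev from hv k).trans_lt (hbc _))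
  filter_upwards [eventually_all.2 hev] with n hn
  calc |(cocycle A f n x).det| ≤ C * ∏ k, ‖orbitVec A f x (v k) n‖ := hC _
    _ ≤ |C| * ∏ k, ‖orbitVec A f x (v k) n‖ :=
        mul_le_mul_of_nonneg_right (le_abs_self C) (Finset.prod_nonneg fun _ _ => norm_nonneg _)
    _ ≤ |C| * ∏ k : Fin d, Real.exp (c k.rev * n) :=
        mul_le_mul_of_nonneg_left
          (Finset.prod_le_prod (fun _ _ => norm_nonneg _) fun k _ => hn k) (abs_nonneg C)
    _ = |C| * Real.exp ((∑ i, c i) * n) := by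
        rw [← Real.exp_sum, Finset.sum_mul]
        congr 2
        exact Equiv.sum_comp Fin.revPerm fun i => c i * n

/-- If the sum of the Lyapunov exponents with respect to `μ` is finite and at most `ρ`, then
`|det Aⁿ(x)|` grows at most like `e^{ρ'n}` for `μ`-almost every `x` and every `ρ' > ρ`. -/
theorem ae_eventually_abs_det_le {M : Type*} [MeasurableSpace M] {d : ℕ}
    (A : M → Matrix (Fin d) (Fin d) ℝ) (f : M → M) {μ : Measure M} {τ ρ ρ' : ℝ}
    (hτ : (τ : EReal) ≤ ∑ i : Fin d, lyapunovExponent A f μ i)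
    (hρ : ∑ i : Fin d, lyapunovExponent A f μ i ≤ (ρ : EReal)) (hρ' : ρ < ρ') :
    ∀ᵐ x ∂μ, ∀ᶠ n : ℕ in atTop, |(cocycle A f n x).det| ≤ Real.exp (ρ' * n) := by
  have hbot : ∀ s : Finset (Fin d), ∑ i ∈ s, lyapunovExponent A f μ i ≠ ⊥ := fun s h => by
    rw [← Finset.sum_sdiff (Finset.subset_univ s), h, EReal.add_bot] at hτ
    exact EReal.coe_ne_bot _ (le_bot_iff.1 hτ)
  have htop : ∀ i, lyapunovExponent A f μ i ≠ ⊤ := fun i h => by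
    rw [← Finset.add_sum_erase _ _ (Finset.mem_univ i), h, EReal.top_add_of_ne_bot (hbot _)] at hρ
    exact EReal.coe_ne_top _ (top_le_iff.1 hρ)
  set g : Fin d → ℝ := fun i => (lyapunovExponent A f μ i).toReal
  have hg : ∀ i, lyapunovExponent A f μ i = (g i : EReal) := fun i =>
    (EReal.coe_toReal (htop i) (by simpa using hbot {i})).symm
  have hsum : ∑ i, g i ≤ ρ := by
    rw [← EReal.coe_le_coe_iff, coe_finsetSum_ereal]
    simpa only [hg] using hρ
  -- Half of the room between `ρ` and `ρ'` absorbs the constant.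
  set ε := (ρ' - ρ) / 2 with hε
  have hεpos : 0 < ε := by rw [hε]; linarith
  have hsum' : ∑ i, (g i + ε / (d + 1)) ≤ ρ + ε := by
    rw [Finset.sum_add_distrib, Finset.sum_const, Finset.card_univ, Fintype.card_fin, nsmul_eq_mul]
    refine add_le_add hsum ?_
    rw [mul_div_assoc', div_le_iff₀ (by positivity)]
    nlinarith
  have hae : ∀ᵐ x ∂μ, ∀ i, lyapunovExponentAt A f x i ≤ lyapunovExponent A f μ i :=
    ae_all_iff.2 fun i => ae_le_essSup
  filter_upwards [hae] with x hx
  obtain ⟨C, hC⟩ := exists_eventually_abs_det_le A f (x := x) (c := fun i => g i + ε / (d + 1))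
    fun i => (hx i).trans_lt (by
      rw [hg, EReal.coe_lt_coe_iff]
      have : 0 < ε / (d + 1) := by positivity
      linarith)
  have hlim : Tendsto (fun n : ℕ => Real.exp (ε * n)) atTop atTop :=
    Real.tendsto_exp_atTop.comp (tendsto_natCast_atTop_atTop.const_mul_atTop hεpos)
  filter_upwards [hC, hlim.eventually_ge_atTop C] with n hn hCn
  calc |(cocycle A f n x).det| ≤ C * Real.exp ((∑ i, (g i + ε / (d + 1))) * n) := hn
    _ ≤ Real.exp (ε * n) * Real.exp ((ρ + ε) * n) :=
        mul_le_mul hCn (Real.exp_le_exp.2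
          (mul_le_mul_of_nonneg_right hsum' (Nat.cast_nonneg n))) (Real.exp_pos _).le
          (Real.exp_pos _).le
    _ = Real.exp (ρ' * n) := by
        rw [← Real.exp_add]
        congr 1
        rw [hε]
        ring

/-! ### Ergodic measures and extreme invariant states -/

/-- The states on `C(M, ℝ)` (positive functionals `L` with `L 1 = 1`) that are invariant under `f`,
as a subset of the weak-* dual. -/
def invariantStates {M : Type*} [TopologicalSpace M] [CompactSpace M] (f : C(M, M)) :
    Set (WeakDual ℝ C(M, ℝ)) :=
  {L | (∀ φ : C(M, ℝ), 0 ≤ φ → 0 ≤ L φ) ∧ L 1 = 1 ∧ ∀ φ : C(M, ℝ), L (φ.comp f) = L φ}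

theorem isCompact_invariantStates {M : Type*} [TopologicalSpace M] [CompactSpace M]
    (f : C(M, M)) : IsCompact (invariantStates f) := by
  refine IsCompact.of_isClosed_subset (WeakDual.isCompact_closedBall (𝕜 := ℝ)
    (0 : StrongDual ℝ C(M, ℝ)) 1) ?_ ?_
  · simp only [invariantStates, Set.ofPred_and, Set.ofPred_forall]
    refine IsClosed.inter ?_ (IsClosed.inter ?_ ?_)
    · exact isClosed_iInter fun φ => isClosed_iInter fun _ =>
        isClosed_le continuous_const (WeakDual.eval_continuous φ)
    · exact isClosed_eq (WeakDual.eval_continuous 1) continuous_const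
    · exact isClosed_iInter fun φ =>
        isClosed_eq (WeakDual.eval_continuous _) (WeakDual.eval_continuous φ)
  · rintro L ⟨hpos, hone, -⟩
    simp only [Set.mem_preimage, Metric.mem_closedBall, dist_zero_right]
    refine ContinuousLinearMap.opNorm_le_bound _ zero_le_one fun φ => ?_
    have h1 : 0 ≤ L (‖φ‖ • 1 - φ) := hpos _ fun x => by
      simpa using (le_abs_self _).trans (φ.norm_coe_le_norm x)
    have h2 : 0 ≤ L (‖φ‖ • 1 + φ) := hpos _ fun x => by
      have := (neg_le_abs _).trans (φ.norm_coe_le_norm x)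
      change (0 : ℝ) ≤ ‖φ‖ * 1 + φ x
      linarith
    rw [map_sub, map_smul, hone, smul_eq_mul, mul_one] at h1
    rw [map_add, map_smul, hone, smul_eq_mul, mul_one] at h2
    rw [one_mul]
    change |L φ| ≤ ‖φ‖
    exact abs_le.2 ⟨by linarith, by linarith⟩

/-- By the Riesz–Markov–Kakutani theorem, invariant states are integrals against invariant
probability measures. -/
theorem exists_measure_of_mem_invariantStates {M : Type*} [MetricSpace M] [CompactSpace M]
    [MeasurableSpace M] [BorelSpace M] {f : C(M, M)} {L : WeakDual ℝ C(M, ℝ)}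
    (hL : L ∈ invariantStates f) :
    ∃ μ : Measure M, IsProbabilityMeasure μ ∧ MeasurePreserving f μ μ ∧
      ∀ φ : C(M, ℝ), ∫ x, φ x ∂μ = L φ := by
  obtain ⟨hpos, hone, hinv⟩ := hL
  let Λ : CompactlySupportedContinuousMap M ℝ →ₚ[ℝ] ℝ := PositiveLinearMap.mk₀
    { toFun := fun φ => L φ.toContinuousMap
      map_add' := fun φ ψ => L.map_add φ.toContinuousMap ψ.toContinuousMap
      map_smul' := fun c φ => L.map_smul c φ.toContinuousMap }
    (fun φ hφ => hpos _ hφ)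
  have hint : ∀ φ : C(M, ℝ), ∫ x, φ x ∂(RealRMK.rieszMeasure Λ) = L φ := fun φ =>
    RealRMK.integral_rieszMeasure Λ (CompactlySupportedContinuousMap.continuousMapEquiv φ)
  have hfin : IsFiniteMeasure (RealRMK.rieszMeasure Λ) := by
    infer_instance
  have hprob : IsProbabilityMeasure (RealRMK.rieszMeasure Λ) := by
    have h := hint 1
    simp only [ContinuousMap.one_apply, integral_const, smul_eq_mul, mul_one, hone] at h
    exact ⟨by rw [← ENNReal.toReal_eq_one_iff]; exact h⟩
  refine ⟨_, hprob, ⟨f.continuous.measurable, ?_⟩, hint⟩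
  have := Measure.isProbabilityMeasure_map (μ := RealRMK.rieszMeasure Λ)
    f.continuous.measurable.aemeasurable
  refine ext_of_forall_integral_eq_of_IsFiniteMeasure fun φ => ?_
  rw [integral_map f.continuous.measurable.aemeasurable
    φ.continuous.measurable.aestronglyMeasurable]
  exact (hint (φ.toContinuousMap.comp f)).trans ((hinv _).trans (hint _).symm)

/-- The functional `φ ↦ ∫ φ dμ`. -/
def integralState {M : Type*} [TopologicalSpace M] [CompactSpace M]
    [MeasurableSpace M] [BorelSpace M] (μ : Measure M) [IsProbabilityMeasure μ] :
    WeakDual ℝ C(M, ℝ) :=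
  LinearMap.mkContinuous (σ := RingHom.id ℝ)
    { toFun := fun φ : C(M, ℝ) => ∫ x, φ x ∂μ
      map_add' := fun φ ψ => integral_add
        (φ.continuous.integrable_of_hasCompactSupport (HasCompactSupport.of_compactSpace _))
        (ψ.continuous.integrable_of_hasCompactSupport (HasCompactSupport.of_compactSpace _))
      map_smul' := fun c φ => integral_const_mul c _ } 1 (fun φ => by
        simpa using norm_integral_le_of_norm_le_const (μ := μ)
          (Eventually.of_forall φ.norm_coe_le_norm))

theorem integralState_apply {M : Type*} [TopologicalSpace M] [CompactSpace M]
    [MeasurableSpace M] [BorelSpace M] (μ : Measure M) [IsProbabilityMeasure μ] (φ : C(M, ℝ)) :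
    integralState μ φ = ∫ x, φ x ∂μ := rfl

theorem integralState_mem {M : Type*} [MetricSpace M] [CompactSpace M]
    [MeasurableSpace M] [BorelSpace M] {f : C(M, M)} {μ : Measure M} [IsProbabilityMeasure μ]
    (hμ : MeasurePreserving f μ μ) : integralState μ ∈ invariantStates f := by
  refine ⟨fun φ hφ => integral_nonneg hφ, ?_, fun φ => ?_⟩
  · simp [integralState_apply]
  · rw [integralState_apply, integralState_apply]
    conv_rhs => rw [← hμ.map_eq]
    exact (integral_map hμ.measurable.aemeasurable
      φ.continuous.measurable.aestronglyMeasurable).symm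

/-- An extreme point of the set of invariant states is integration against an ergodic measure. -/
theorem exists_ergodic_of_mem_extremePoints {M : Type*} [MetricSpace M] [CompactSpace M]
    [MeasurableSpace M] [BorelSpace M] {f : C(M, M)} {L : WeakDual ℝ C(M, ℝ)}
    (hL : L ∈ (invariantStates f).extremePoints ℝ) :
    ∃ μ : Measure M, IsProbabilityMeasure μ ∧ Ergodic f μ ∧
      ∀ φ : C(M, ℝ), ∫ x, φ x ∂μ = L φ := by
  obtain ⟨μ, hμ, hinv, hint⟩ := exists_measure_of_mem_invariantStates hL.1
  refine ⟨μ, hμ, Ergodic.of_mem_extremePoints ⟨⟨hinv, hμ⟩, ?_⟩, hint⟩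
  rintro ν₁ ⟨hν₁, hp₁⟩ ν₂ ⟨hν₂, hp₂⟩ ⟨a, b, ha, hb, hab, habμ⟩
  have ha' : a ≠ ⊤ := ne_top_of_le_ne_top ENNReal.one_ne_top (hab ▸ le_self_add)
  have hb' : b ≠ ⊤ := ne_top_of_le_ne_top ENNReal.one_ne_top (hab ▸ le_add_self)
  have hcomb : a.toReal • integralState ν₁ + b.toReal • integralState ν₂ = L := by
    refine ContinuousLinearMap.ext fun φ => ?_
    have hi : ∀ ν : Measure M, IsProbabilityMeasure ν → Integrable φ ν := fun ν _ =>
      φ.continuous.integrable_of_hasCompactSupport (HasCompactSupport.of_compactSpace _)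
    refine Eq.trans ?_ (hint φ)
    rw [← habμ, integral_add_measure ((hi _ hp₁).smul_measure ha') ((hi _ hp₂).smul_measure hb'),
      integral_smul_measure, integral_smul_measure]
    rfl
  have key : integralState ν₁ = L := hL.2 (integralState_mem hν₁) (integralState_mem hν₂)
    ⟨a.toReal, b.toReal, ENNReal.toReal_pos ha.ne' ha', ENNReal.toReal_pos hb.ne' hb',
      by rw [← ENNReal.toReal_add ha' hb', hab, ENNReal.toReal_one], hcomb⟩
  refine ext_of_forall_integral_eq_of_IsFiniteMeasure fun φ => ?_
  rw [show ∫ x, φ x ∂ν₁ = integralState ν₁ φ.toContinuousMap from rfl, key]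
  exact (hint _).symm

/-- If for every `K` some invariant state gives `φ K` at least the value `c`, where `φ` is a
decreasing sequence, then one ergodic measure does so for all `K`. The invariant states that
maximize the upper semicontinuous affine functional `L ↦ inf_K L (φ K)` form a nonempty compact
face of the set of all invariant states, hence contain an extreme point of that set. -/
theorem exists_ergodic_forall_le_integral {M : Type*} [MetricSpace M] [CompactSpace M]
    [MeasurableSpace M] [BorelSpace M] (f : C(M, M)) {φ : ℕ → C(M, ℝ)} (hφ : Antitone φ) {c : ℝ}
    (hc : ∀ K, ∃ L ∈ invariantStates f, c ≤ L (φ K)) :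
    ∃ μ : Measure M, IsProbabilityMeasure μ ∧ Ergodic f μ ∧ ∀ K, c ≤ ∫ x, φ K x ∂μ := by
  have hmono : ∀ L ∈ invariantStates f, Antitone fun K => L (φ K) := fun L hL i j hij => by
    have := hL.1 (φ i - φ j) (sub_nonneg.2 (hφ hij))
    rw [map_sub] at this
    linarith
  set C : Set ℝ := {b | ∀ K, ∃ L ∈ invariantStates f, b ≤ L (φ K)}
  have hmax : ∀ K, ∃ L ∈ invariantStates f, ∀ L' ∈ invariantStates f, L' (φ K) ≤ L (φ K) :=
    fun K => (isCompact_invariantStates f).exists_isMaxOn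
      (let ⟨L, hL, _⟩ := hc K; ⟨L, hL⟩) (WeakDual.eval_continuous (φ K)).continuousOn
  choose Lm hLm hLmax using hmax
  have hbdd : ∀ K, Lm K (φ K) ∈ upperBounds C := fun K b hb => by
    obtain ⟨L, hL, hbL⟩ := hb K
    exact hbL.trans (hLmax K L hL)
  set F : ℕ → Set (WeakDual ℝ C(M, ℝ)) :=
    fun K => {L | L ∈ invariantStates f ∧ sSup C ≤ L (φ K)} with hF
  have hFclosed : ∀ K, IsClosed (F K) := fun K =>
    (isCompact_invariantStates f).isClosed.inter
      (isClosed_le continuous_const (WeakDual.eval_continuous (φ K)))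
  have hFcompact : ∀ K, IsCompact (F K) := fun K =>
    (isCompact_invariantStates f).of_isClosed_subset (hFclosed K) fun L hL => hL.1
  have hFne : (⋂ K, F K).Nonempty :=
    IsCompact.nonempty_iInter_of_sequence_nonempty_isCompact_isClosed F
      (fun K L hL => ⟨hL.1, hL.2.trans (hmono L hL.1 K.le_succ)⟩)
      (fun K => ⟨Lm K, hLm K, csSup_le ⟨c, hc⟩ (hbdd K)⟩) (hFcompact 0) hFclosed
  have hext : IsExtreme ℝ (invariantStates f) (⋂ K, F K) := by
    refine ⟨fun L hL => (Set.mem_iInter.1 hL 0).1, ?_⟩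
    rintro L₁ hL₁ L₂ hL₂ L hL ⟨a, b, ha, hb, hab, rfl⟩
    by_contra hcon
    obtain ⟨K₀, hK₀⟩ : ∃ K, L₁ (φ K) < sSup C := by
      simpa [hF, hL₁] using hcon
    have hmem : sSup C + a / b * (sSup C - L₁ (φ K₀)) ∈ C := fun K => by
      refine ⟨L₂, hL₂, le_trans ?_ (hmono L₂ hL₂ (le_max_left K K₀))⟩
      have h1 := (Set.mem_iInter.1 hL (max K K₀)).2
      have h2 := hmono L₁ hL₁ (le_max_right K K₀)
      change sSup C ≤ a * L₁ (φ (max K K₀)) + b * L₂ (φ (max K K₀)) at h1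
      simp only at h2
      have h3 := mul_le_mul_of_nonneg_left h2 ha.le
      obtain rfl : a = 1 - b := by linarith
      field_simp
      linarith
    have h := le_csSup ⟨_, hbdd 0⟩ hmem
    have : 0 < a / b * (sSup C - L₁ (φ K₀)) := mul_pos (div_pos ha hb) (by linarith)
    linarith
  have : LocallyConvexSpace ℝ (WeakDual ℝ C(M, ℝ)) :=
    inferInstanceAs (LocallyConvexSpace ℝ (WeakBilin (topDualPairing ℝ C(M, ℝ))))
  obtain ⟨L, hL⟩ := ((hFcompact 0).of_isClosed_subset (isClosed_iInter hFclosed)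
    (Set.iInter_subset _ 0)).extremePoints_nonempty hFne
  obtain ⟨μ, hμ, herg, hint⟩ := exists_ergodic_of_mem_extremePoints
    (hext.extremePoints_subset_extremePoints hL)
  refine ⟨μ, hμ, herg, fun K => ?_⟩
  rw [hint]
  exact (le_csSup ⟨_, hbdd 0⟩ hc).trans (Set.mem_iInter.1 hL.1 K).2

/-! ### Truncated logarithms and Fatou's lemma -/

/-- The function `log (max g e^{-K})`, a continuous approximation from above of `log g`. -/
def truncLog {M : Type*} [TopologicalSpace M] (g : C(M, ℝ)) (K : ℕ) : C(M, ℝ) where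
  toFun x := Real.log (max (g x) (Real.exp (-K)))
  continuous_toFun := Continuous.log (by fun_prop) fun x =>
    (lt_max_of_lt_right (Real.exp_pos _)).ne'

theorem antitone_truncLog {M : Type*} [TopologicalSpace M] (g : C(M, ℝ)) :
    Antitone (truncLog g) := fun _ _ hKL _ =>
  Real.log_le_log (lt_max_of_lt_right (Real.exp_pos _))
    (max_le_max le_rfl (Real.exp_le_exp.2 (neg_le_neg (Nat.cast_le.2 hKL))))

theorem sum_truncLog {M ι : Type*} [TopologicalSpace M] (g : C(M, ℝ)) (K : ℕ) (s : Finset ι)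
    (u : ι → M) :
    ∑ i ∈ s, truncLog g K (u i) = Real.log (∏ i ∈ s, max (g (u i)) (Real.exp (-K))) :=
  (Real.log_prod fun _ _ => (lt_max_of_lt_right (Real.exp_pos _)).ne').symm

theorem exists_truncLog_le {M : Type*} [TopologicalSpace M] [CompactSpace M] (g : C(M, ℝ)) :
    ∃ b : ℝ, ∀ K x, truncLog g K x ≤ b := by
  refine ⟨Real.log (max ‖g‖ 1), fun K x => Real.log_le_log
    (lt_max_of_lt_right (Real.exp_pos _)) (max_le_max ?_ ?_)⟩
  · exact (le_abs_self _).trans (g.norm_coe_le_norm x)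
  · exact Real.exp_le_one_iff.2 (neg_nonpos.2 (Nat.cast_nonneg K))

theorem exists_sum_truncLog_le {M : Type*} [TopologicalSpace M] {g : C(M, ℝ)} (hg : 0 ≤ g)
    {n : ℕ} {u : ℕ → M} {a : ℝ} (h : ∏ j ∈ Finset.range n, g (u j) < Real.exp a) :
    ∃ K, ∑ j ∈ Finset.range n, truncLog g K (u j) ≤ a := by
  have hexp : Tendsto (fun K : ℕ => Real.exp (-(K : ℝ))) atTop (nhds 0) :=
    Real.tendsto_exp_neg_atTop_nhds_zero.comp tendsto_natCast_atTop_atTop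
  have hlim : Tendsto (fun K : ℕ => ∏ j ∈ Finset.range n, max (g (u j)) (Real.exp (-K))) atTop
      (nhds (∏ j ∈ Finset.range n, g (u j))) := by
    refine tendsto_finsetProd _ fun j _ => ?_
    have h1 := (tendsto_const_nhds (x := g (u j)) (f := atTop)).max hexp
    rwa [max_eq_left (show 0 ≤ g (u j) from hg (u j))] at h1
  obtain ⟨K, hK⟩ := (hlim.eventually_lt_const h).exists
  refine ⟨K, ?_⟩
  rw [sum_truncLog]
  exact (Real.log_le_iff_le_exp (Finset.prod_pos fun _ _ =>
    lt_max_of_lt_right (Real.exp_pos _))).2 hK.le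

/-- If `∏_{j<n} g (fʲ x)` grows at most like `e^{ρn}` almost everywhere, then `∫ log g dμ ≤ ρ`, where
the integral of `log g` enters through its truncations. Fatou's lemma is applied to the Birkhoff
averages of the nonnegative function `b - log g`, where `b` is an upper bound of `log g`. -/
theorem le_of_ae_eventually_prod_le {M : Type*} [TopologicalSpace M] [CompactSpace M]
    [MeasurableSpace M] [BorelSpace M] {f : M → M} {μ : Measure M} [IsProbabilityMeasure μ]
    (hf : MeasurePreserving f μ μ) {g : C(M, ℝ)} (hg : 0 ≤ g) {c ρ ρ' : ℝ} (hρ : ρ < ρ')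
    (hc : ∀ K, c ≤ ∫ x, truncLog g K x ∂μ)
    (h : ∀ᵐ x ∂μ, ∀ᶠ n : ℕ in atTop, ∏ j ∈ Finset.range n, g (f^[j] x) ≤ Real.exp (ρ * n)) :
    c ≤ ρ' := by
  obtain ⟨b, hb⟩ := exists_truncLog_le g
  have hint : ∀ K, Integrable (truncLog g K) μ := fun K =>
    (truncLog g K).continuous.integrable_of_hasCompactSupport (HasCompactSupport.of_compactSpace _)
  have hcb : c ≤ b := (hc 0).trans (by
    simpa using integral_mono (hint 0) (integrable_const b) (hb 0))
  set H : ℕ → M → ENNReal := fun K x => ENNReal.ofReal (b - truncLog g K x)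
  have hHm : ∀ K, Measurable (H K) := fun K =>
    ((measurable_const.sub (truncLog g K).continuous.measurable)).ennreal_ofReal
  have hHmono : Monotone H := fun K L hKL x =>
    ENNReal.ofReal_le_ofReal (sub_le_sub_left (antitone_truncLog g hKL x) b)
  set h' : M → ENNReal := fun x => ⨆ K, H K x
  have hm' : Measurable h' := Measurable.iSup hHm
  have hlint : ∫⁻ x, h' x ∂μ ≤ ENNReal.ofReal (b - c) := by
    rw [lintegral_iSup hHm hHmono]
    refine iSup_le fun K => ?_
    have hI : Integrable (fun x => b - truncLog g K x) μ := (integrable_const b).sub (hint K)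
    rw [← ofReal_integral_eq_lintegral_ofReal hI
      (Eventually.of_forall fun x => sub_nonneg.2 (hb K x)),
      integral_sub (integrable_const b) (hint K)]
    rw [integral_const, probReal_univ, one_smul]
    exact ENNReal.ofReal_le_ofReal (sub_le_sub_left (hc K) b)
  set a : ℕ → M → ENNReal := fun n x => (∑ j ∈ Finset.range n, h' (f^[j] x)) / n with ha
  have hiter : ∀ j, Measurable fun x => h' (f^[j] x) := fun j =>
    hm'.comp (hf.measurable.iterate j)
  have ham : ∀ n, Measurable (a n) := fun n =>
    (Finset.measurable_fun_sum _ fun j _ => hiter j).div_const _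
  have haint : ∀ n : ℕ, 0 < n → ∫⁻ x, a n x ∂μ = ∫⁻ x, h' x ∂μ := fun n hn => by
    simp only [ha, div_eq_mul_inv]
    rw [lintegral_mul_const _ (Finset.measurable_fun_sum _ fun j _ => hiter j),
      lintegral_finsetSum _ fun j _ => hiter j]
    simp only [(hf.iterate _).lintegral_comp hm', Finset.sum_const, Finset.card_range,
      nsmul_eq_mul]
    rw [mul_comm, ← mul_assoc, ENNReal.inv_mul_cancel (by exact_mod_cast hn.ne')
      (ENNReal.natCast_ne_top n), one_mul]
  have hliminf : ∀ᵐ x ∂μ, ENNReal.ofReal (b - ρ') ≤ liminf (fun n => a n x) atTop := by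
    filter_upwards [h] with x hx
    refine le_liminf_of_le (by isBoundedDefault) ?_
    filter_upwards [hx, eventually_gt_atTop 0] with n hn hn0
    have hn0' : (0 : ℝ) < n := by exact_mod_cast hn0
    obtain ⟨K, hK⟩ := exists_sum_truncLog_le hg (u := fun j => f^[j] x) (a := ρ' * n)
      (hn.trans_lt (Real.exp_lt_exp.2 (mul_lt_mul_of_pos_right hρ hn0')))
    rw [ha, ENNReal.le_div_iff_mul_le (Or.inl (by exact_mod_cast hn0.ne'))
      (Or.inl (ENNReal.natCast_ne_top n)), ← ENNReal.ofReal_natCast,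
      ← ENNReal.ofReal_mul' hn0'.le]
    calc ENNReal.ofReal ((b - ρ') * n)
        ≤ ENNReal.ofReal (∑ j ∈ Finset.range n, (b - truncLog g K (f^[j] x))) := by
          refine ENNReal.ofReal_le_ofReal ?_
          rw [Finset.sum_sub_distrib, Finset.sum_const, Finset.card_range, nsmul_eq_mul]
          linarith
      _ = ∑ j ∈ Finset.range n, H K (f^[j] x) :=
          ENNReal.ofReal_sum_of_nonneg fun j _ => sub_nonneg.2 (hb K _)
      _ ≤ ∑ j ∈ Finset.range n, h' (f^[j] x) :=
          Finset.sum_le_sum fun j _ => le_iSup (fun K => H K (f^[j] x)) K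
  have key : ENNReal.ofReal (b - ρ') ≤ ENNReal.ofReal (b - c) :=
    calc ENNReal.ofReal (b - ρ') = ∫⁻ _, ENNReal.ofReal (b - ρ') ∂μ := by simp
      _ ≤ ∫⁻ x, liminf (fun n => a n x) atTop ∂μ := lintegral_mono_ae hliminf
      _ ≤ liminf (fun n => ∫⁻ x, a n x ∂μ) atTop := lintegral_liminf_le ham
      _ = liminf (fun _ : ℕ => ∫⁻ x, h' x ∂μ) atTop :=
          liminf_congr ((eventually_gt_atTop 0).mono haint)
      _ = ∫⁻ x, h' x ∂μ := liminf_const _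
      _ ≤ ENNReal.ofReal (b - c) := hlint
  rcases ENNReal.ofReal_le_ofReal_iff'.1 key with h | h <;> linarith

/-! ### The determinant of a Hölder continuous matrix function -/

theorem IsHolder.exists_entry_sub_le {M : Type*} [MetricSpace M] {d : ℕ}
    {A : M → Matrix (Fin d) (Fin d) ℝ} {α : ℝ} (hA : IsHolder A α) :
    ∃ C : ℝ, 0 < C ∧ ∀ x y i j, |A x i j - A y i j| ≤ C * dist x y ^ α := by
  obtain ⟨C, hC, h⟩ := hA
  refine ⟨C, hC, fun x y i j => le_trans ?_ (h x y)⟩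
  have h1 : A x i j - A y i j = Matrix.toEuclideanCLM (n := Fin d) (𝕜 := ℝ) (A x - A y)
      (EuclideanSpace.single j 1) i := by
    rw [Matrix.ofLp_toEuclideanCLM]
    simp
  rw [h1, ← Real.norm_eq_abs]
  refine (PiLp.norm_apply_le _ _).trans ((ContinuousLinearMap.le_opNorm _ _).trans ?_)
  simp

theorem IsHolder.continuous {M : Type*} [MetricSpace M] {d : ℕ}
    {A : M → Matrix (Fin d) (Fin d) ℝ} {α : ℝ} (hα : 0 < α) (hA : IsHolder A α) :
    Continuous A := by
  obtain ⟨C, -, h⟩ := hA.exists_entry_sub_le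
  refine continuous_matrix fun i j => continuous_iff_continuousAt.2 fun x => ?_
  refine tendsto_iff_dist_tendsto_zero.2 (squeeze_zero (fun _ => dist_nonneg)
    (fun y => h y x i j) ?_)
  have hd : Tendsto (fun y => dist y x) (nhds x) (nhds 0) := tendsto_iff_dist_tendsto_zero.1
    tendsto_id
  have := (hd.rpow_const (p := α) (Or.inr hα.le)).const_mul C
  rwa [Real.zero_rpow hα.ne', mul_zero] at this

/-- Near a point where it vanishes, the determinant is bounded by a multiple of `dist ^ α`. -/
theorem IsHolder.exists_abs_det_le {M : Type*} [MetricSpace M] {d : ℕ}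
    {A : M → Matrix (Fin d) (Fin d) ℝ} {α : ℝ} (hα : 0 < α) (hA : IsHolder A α) {x : M}
    (hx : (A x).det = 0) :
    ∃ D : ℝ, 0 < D ∧ ∀ᶠ y in nhds x, |(A y).det| ≤ D * dist y x ^ α := by
  obtain ⟨C, hC, h⟩ := hA.exists_entry_sub_le
  let F : (Fin d → Fin d → ℝ) → ℝ := fun B => Matrix.det (Matrix.of B)
  have hF : DifferentiableAt ℝ F (A x) := by
    simp only [F, Matrix.det_apply', Matrix.of_apply]
    fun_prop
  obtain ⟨D, hD, hbound⟩ := hF.isBigO_sub.exists_pos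
  refine ⟨D * C, mul_pos hD hC, ?_⟩
  have hcont : Tendsto A (nhds x) (nhds (A x)) := (hA.continuous hα).continuousAt
  filter_upwards [hcont.eventually hbound.bound] with y hy
  have h1 : F (A x) = 0 := hx
  rw [h1, sub_zero] at hy
  refine (show |(A y).det| ≤ _ from hy).trans ?_
  rw [mul_assoc]
  refine mul_le_mul_of_nonneg_left ?_ hD.le
  have hnn : 0 ≤ C * dist y x ^ α := mul_nonneg hC.le (Real.rpow_nonneg dist_nonneg _)
  exact (pi_norm_le_iff_of_nonneg hnn).2 fun i =>
    (pi_norm_le_iff_of_nonneg hnn).2 fun j => h y x i j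

/-! ### Periodic orbits passing close to a zero of the determinant -/

theorem integral_orbitMeasure {M : Type*} [MeasurableSpace M] [MeasurableSingletonClass M]
    (f : M → M) (N : ℕ) (x : M) (φ : M → ℝ) :
    ∫ y, φ y ∂orbitMeasure f N x = (∑ j ∈ Finset.range N, φ (f^[j] x)) / N := by
  rw [orbitMeasure, integral_smul_measure, integral_finsetSum_measure fun j _ =>
    integrable_dirac (by simp)]
  simp only [integral_dirac, ENNReal.toReal_inv, ENNReal.toReal_natCast, smul_eq_mul]
  rw [inv_mul_eq_div]

/-- If the product of `g` along an orbit segment is at least `e^{-a}` although one factor is at most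
`e^{-l}`, then the remaining factors contribute at least `l - a` to the sum of the truncated
logarithms, and the small factor at least `-K`. -/
theorem sub_le_sum_truncLog {M : Type*} [TopologicalSpace M] {g : C(M, ℝ)} (hg : 0 ≤ g) (K : ℕ)
    {N m : ℕ} (hm : m < N) {u : ℕ → M} {a l : ℝ}
    (h : Real.exp (-a) ≤ ∏ j ∈ Finset.range N, g (u j)) (hl : g (u m) ≤ Real.exp (-l)) :
    l - a - K ≤ ∑ j ∈ Finset.range N, truncLog g K (u j) := by
  have hmem : m ∈ Finset.range N := Finset.mem_range.2 hm
  set P := ∏ j ∈ (Finset.range N).erase m, g (u j)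
  have hP0 : 0 ≤ P := Finset.prod_nonneg fun j _ => hg (u j)
  rw [← Finset.mul_prod_erase _ _ hmem] at h
  have h1 : Real.exp (l - a) ≤ P := by
    have h2 : Real.exp (-a) ≤ Real.exp (-l) * P := h.trans (mul_le_mul_of_nonneg_right hl hP0)
    calc Real.exp (l - a) = Real.exp l * Real.exp (-a) := by rw [← Real.exp_add, sub_eq_add_neg]
      _ ≤ Real.exp l * (Real.exp (-l) * P) := mul_le_mul_of_nonneg_left h2 (Real.exp_pos _).le
      _ = P := by rw [← mul_assoc, ← Real.exp_add, add_neg_cancel, Real.exp_zero, one_mul]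
  rw [sum_truncLog, Real.le_log_iff_exp_le
    (Finset.prod_pos fun _ _ => lt_max_of_lt_right (Real.exp_pos _)),
    ← Finset.mul_prod_erase _ _ hmem]
  calc Real.exp (l - a - K) = Real.exp (-K) * Real.exp (l - a) := by
        rw [← Real.exp_add]
        congr 1
        ring
    _ ≤ Real.exp (-K) * ∏ j ∈ (Finset.range N).erase m, max (g (u j)) (Real.exp (-K)) :=
        mul_le_mul_of_nonneg_left (h1.trans (Finset.prod_le_prod (fun j _ => hg (u j))
          fun j _ => le_max_left _ _)) (Real.exp_pos _).le
    _ ≤ _ := mul_le_mul_of_nonneg_right (le_max_right _ _)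
        (Finset.prod_nonneg fun j _ => (hg (u j)).trans (le_max_left _ _))

theorem PeriodicExpSpecification.exists_periodic_near {M : Type*} [MetricSpace M] (f : M ≃ₜ M)
    {θ : ℝ} (hf : PeriodicExpSpecification f θ) (x : M) :
    ∃ S : ℕ, 0 < S ∧ ∀ m : ℕ, ∃ p : M, f^[2 * m + S] p = p ∧
      dist (f^[m] p) x < Real.exp (-(θ * m)) := by
  obtain ⟨S, hS, h⟩ := hf.2 1 one_pos
  refine ⟨S, hS, fun m => ?_⟩
  obtain ⟨p, hp, hdist⟩ := h (f.symm^[m] x) (2 * m)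
  refine ⟨p, hp, ?_⟩
  have h1 := hdist m (by omega)
  have h2 : f^[m] (f.symm^[m] x) = x :=
    Function.RightInverse.iterate f.apply_symm_apply m x
  have h3 : ((2 * m : ℕ) : ℝ) - m = m := by push_cast; ring
  rwa [h2, h3, min_self, one_mul, neg_mul] at h1

end SemiInvertible

end


theorem theorem2p1 {M : Type*} [MetricSpace M] [CompactSpace M] [MeasurableSpace M] [BorelSpace M]
    (f : M ≃ₜ M) {θ : ℝ} (hf : SemiInvertible.PeriodicExpSpecification f θ)
    {d : ℕ} (A : M → Matrix (Fin d) (Fin d) ℝ) {α : ℝ} (hα : 0 < α)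
    (hA : SemiInvertible.IsHolder A α)
    {ρ τ : ℝ} (hρ : 0 < ρ) (hτ : 0 < τ) (hρτ : ρ + τ < α * θ / 2)
    (hγ : ∀ μ : Measure M, IsProbabilityMeasure μ → Ergodic f μ →
      ((-τ : ℝ) : EReal) ≤ ∑ i : Fin d, SemiInvertible.lyapunovExponent A f μ i ∧
        ∑ i : Fin d, SemiInvertible.lyapunovExponent A f μ i ≤ (ρ : EReal)) :
    ∀ x : M, IsUnit (A x) := by
  open SemiInvertible in
  intro x
  by_contra hx
  have hdet : (A x).det = 0 := by
    rwa [Matrix.isUnit_iff_isUnit_det, isUnit_iff_ne_zero, not_not] at hx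
  set g : C(M, ℝ) := ⟨fun y => |(A y).det|, (hA.continuous hα).matrix_det.abs⟩
  have hg : 0 ≤ g := fun y => abs_nonneg _
  have hgA : ∀ n y, |(cocycle A f n y).det| = ∏ j ∈ Finset.range n, g (f^[j] y) := fun n y => by
    rw [det_cocycle, Finset.abs_prod]
    rfl
  set f' : C(M, M) := ⟨f, f.continuous⟩
  obtain ⟨S, hS, hp⟩ := hf.exists_periodic_near f x
  choose p hper hdist using hp
  obtain ⟨D, hD, hDnear⟩ := hA.exists_abs_det_le hα hdet
  have hθ : 0 < θ := hf.1
  have hlim : Tendsto (fun m => f^[m] (p m)) atTop (nhds x) := by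
    refine tendsto_iff_dist_tendsto_zero.2 (squeeze_zero (fun _ => dist_nonneg)
      (fun m => (hdist m).le) ?_)
    exact Real.tendsto_exp_neg_atTop_nhds_zero.comp
      (tendsto_natCast_atTop_atTop.const_mul_atTop hθ)
  have hsmall : ∀ᶠ m : ℕ in atTop,
      g (f^[m] (p m)) ≤ Real.exp (-(α * θ * m - Real.log D)) := by
    filter_upwards [hlim.eventually hDnear] with m hm
    refine (show g (f^[m] (p m)) ≤ _ from hm).trans ?_
    calc D * dist (f^[m] (p m)) x ^ α ≤ D * Real.exp (-(θ * m)) ^ α :=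
          mul_le_mul_of_nonneg_left
            (Real.rpow_le_rpow dist_nonneg (hdist m).le hα.le) hD.le
      _ = Real.exp (-(α * θ * m - Real.log D)) := by
          rw [← Real.exp_mul, neg_sub, sub_eq_add_neg, Real.exp_add, Real.exp_log hD]
          congr 2
          ring
  -- The Lyapunov exponents of periodic orbits bound the determinant from below.
  have hlow : ∀ m, Real.exp (-(τ * (2 * m + S : ℕ))) ≤
      ∏ j ∈ Finset.range (2 * m + S), g (f^[j] (p m)) := fun m => by
    have hpos : 0 < 2 * m + S := by omega
    rw [← hgA, ← neg_mul]
    exact exp_le_abs_det_of_periodic A hpos (hper m) (hγ _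
      (isProbabilityMeasure_orbitMeasure f hpos _)
      (ergodic_orbitMeasure f.continuous.measurable (hper m))).1
  obtain ⟨ρ₁, hρ₁, h1⟩ := exists_between (show ρ < α * θ / 2 - τ by linarith)
  obtain ⟨ρ₂, hρ₂, h2⟩ := exists_between h1
  obtain ⟨c, hc, h3⟩ := exists_between h2
  -- Far out in the sequence, `p m` passes so close to `x` that the other points of its orbit
  -- have to compensate for the small factor, which raises the average of `log g`.
  have hstate : ∀ K, ∃ L ∈ invariantStates f', c ≤ L (truncLog g K) := fun K => by
    have hgrow : Tendsto (fun m : ℕ => (α * θ - 2 * τ - 2 * c) * (m : ℝ)) atTop atTop :=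
      tendsto_natCast_atTop_atTop.const_mul_atTop (by linarith)
    obtain ⟨m, hm, hmgrow⟩ := (hsmall.and (hgrow.eventually_ge_atTop
      ((c + τ) * S + Real.log D + K))).exists
    have hpos : 0 < 2 * m + S := by omega
    have := isProbabilityMeasure_orbitMeasure f hpos (p m)
    refine ⟨integralState (orbitMeasure f (2 * m + S) (p m)), integralState_mem
      (ergodic_orbitMeasure f.continuous.measurable (hper m)).toMeasurePreserving, ?_⟩
    have hsum := sub_le_sum_truncLog hg K (show m < 2 * m + S by omega)
      (u := fun j => f^[j] (p m)) (hlow m) hm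
    rw [integralState_apply, integral_orbitMeasure, le_div_iff₀ (by exact_mod_cast hpos)]
    refine le_trans ?_ hsum
    push_cast
    linarith
  obtain ⟨μ, hμ, herg, hint⟩ := exists_ergodic_forall_le_integral f' (antitone_truncLog g) hstate
  have hae := ae_eventually_abs_det_le A f (hγ μ hμ herg).1 (hγ μ hμ herg).2 hρ₁
  simp only [hgA] at hae
  exact absurd (le_of_ae_eventually_prod_le herg.toMeasurePreserving hg hρ₂ hint hae) hc.not_ge
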